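/- All matroids have finite ground sets. Fix a field $K$ of characteristic zero. For a matroid $M$ on an $n$-element set $E$ with rank function $r$, and an ordering $\pi=(e_1,\dots,e_n)$ of $E$, let $\underline r(\pi)=r_1r_2\cdots r_n$ where $r_j=r(\{e_1,\dots,e_j\})-r(\{e_1,\dots,e_{j-1}\})$. The $\mathcal G$-invariant of $M$ is the formal sum $\mathcal G(M)=\sum_\pi[\underline r(\pi)]$ over all $n!$ orderings of $E$, an element of the $K$-vector space with one basis symbol $[\underline r]$ for each finite sequence $\underline r$. A cyclic flat of $M$ is a flat that is a (possibly empty) union of circuits; $\mathcal Z(M)$ is the lattice of cyclic flats ordered by inclusion. A pinchpoint of $\mathcal Z(M)$ is a cyclic flat, neither the maximum nor the minimum of $\mathcal Z(M)$, that each cyclic flat either contains or is contained in. For matroids $M_1,M_2$ on disjoint sets $E_1,E_2$, the free product $M_1\mathbin{\Box}M_2$ is the matroid on $E_1\cup E_2$ whose bases are the sets $B\subseteq E_1\cup E_2$ with $|B|=r(M_1)+r(M_2)$ such that $B\cap E_1$ is independent in $M_1$ and $B\cap E_2$ spans $M_2$. It is proper if each of $M_1$, $M_2$ has at least two cyclic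 flats, and sharp if it is proper, $M_1$ has no coloops and $M_2$ has no loops. Theorem. (1) Whether $M$ is a proper free product is determined by $\mathcal G(M)$: if $\mathcal G(M)=\mathcal G(N)$, then $M$ is a proper free product if and only if $N$ is. (2) Let $X$ be a pinchpoint of $\mathcal Z(M)$. Then $M=(M|X)\mathbin{\Box}(M/X)$ is a sharp free product factorization of $M$, and it is the only sharp factorization $M=M_1\mathbin{\Box}M_2$ with $E(M_1)=X$. The $\mathcal G$-invariants of its constituents $M|X$ and $M/X$ are determined by $\mathcal G(M)$ and $r(X)$: if $X$ is a pinchpoint of $\mathcal Z(M)$, $Y$ is a pinchpoint of $\mathcal Z(N)$, $\mathcal G(M)=\mathcal G(N)$ and $r_M(X)=r_N(Y)$, then $\mathcal G(M|X)=\mathcal G(N|Y)$ and $\mathcal G(M/X)=\mathcal G(N/Y)$. -/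

import Mathlib

namespace FreeProd

open Set

/-- The rank `r(X)` as a natural number (used for matroids on finite ground sets only, where the
rank is never infinite). -/
noncomputable def rk {α : Type*} (M : Matroid α) (X : Set α) : ℕ := (M.eRk X).toNat

/-- The rank sequence `r₁ r₂ … rₙ` of an ordering `π` of the ground set, that is, of a bijection
from the `n` positions to the ground set: the term at position `j` is
`r({π(i) : i ≤ j}) - r({π(i) : i < j})`. (Ranks are monotone, so the subtraction is exact.) -/
noncomputable def rankSequence {α : Type*} (M : Matroid α) (π : Fin M.E.ncard ≃ M.E) : List ℕ :=
  List.ofFn fun j : Fin M.E.ncard =>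
    rk M ((fun i => (π i : α)) '' Iic j) - rk M ((fun i => (π i : α)) '' Iio j)

/-- The `𝒢`-invariant of a matroid on a finite set: the formal sum, over all orderings `π` of the
ground set, of the symbols `[r(π)]`. The vector space of formal linear combinations of symbols of
finite sequences, with coefficients in `K`, contains each `𝒢(n, r)` as the span of the symbols of
the `(n, r)`-sequences. -/
noncomputable def gInvariant (K : Type*) [Field K] {α : Type*} (M : Matroid α) : List ℕ →₀ K :=
  ∑ᶠ π : Fin M.E.ncard ≃ M.E, Finsupp.single (rankSequence M π) 1

/-- A set is cyclic if it is a (possibly empty) union of circuits. -/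
def IsCyclic {α : Type*} (M : Matroid α) (X : Set α) : Prop :=
  ∃ 𝒞 : Set (Set α), (∀ C ∈ 𝒞, M.IsCircuit C) ∧ X = ⋃₀ 𝒞

/-- The set `𝒵(M)` of cyclic flats of `M`, which is ordered by inclusion. -/
def cyclicFlats {α : Type*} (M : Matroid α) : Set (Set α) := {F | M.IsFlat F ∧ IsCyclic M F}

/-- A pinchpoint of `𝒵(M)` is a cyclic flat, neither the maximum nor the minimum of `𝒵(M)`, that
each cyclic flat either contains or is contained in. -/
structure IsPinchpoint {α : Type*} (M : Matroid α) (X : Set α) : Prop where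
  mem : X ∈ cyclicFlats M
  not_greatest : ¬ IsGreatest (cyclicFlats M) X
  not_least : ¬ IsLeast (cyclicFlats M) X
  comparable : ∀ F ∈ cyclicFlats M, X ⊆ F ∨ F ⊆ X

/-- `M` is the free product of `M₁` and `M₂` (in this order): the ground sets `E₁` and `E₂` are
disjoint, `M` is a matroid on `E₁ ∪ E₂`, and its bases are the subsets `B` of `E₁ ∪ E₂` of size
`r(M₁) + r(M₂)` such that `B ∩ E₁` is independent in `M₁` and `B ∩ E₂` spans `M₂`. -/
structure IsFreeProduct {α : Type*} (M M₁ M₂ : Matroid α) : Prop where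
  disjoint : Disjoint M₁.E M₂.E
  ground : M.E = M₁.E ∪ M₂.E
  isBase_iff : ∀ B : Set α, M.IsBase B ↔
    B ⊆ M₁.E ∪ M₂.E ∧ B.encard = M₁.eRank + M₂.eRank ∧
      M₁.Indep (B ∩ M₁.E) ∧ M₂.Spanning (B ∩ M₂.E)

/-- A free product factorization is proper if each factor has at least two cyclic flats. -/
structure IsProperFactorization {α : Type*} (M M₁ M₂ : Matroid α) : Prop
    extends IsFreeProduct M M₁ M₂ where
  left_nontrivial : (cyclicFlats M₁).Nontrivial
  right_nontrivial : (cyclicFlats M₂).Nontrivial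

/-- A proper free product factorization is sharp if the first factor has no coloops and the second
factor has no loops. -/
structure IsSharpFactorization {α : Type*} (M M₁ M₂ : Matroid α) : Prop
    extends IsProperFactorization M M₁ M₂ where
  left_no_coloops : M₁.coloops = ∅
  right_no_loops : M₂.loops = ∅

/-- `M` is a proper free product. -/
def IsProperFreeProduct {α : Type*} (M : Matroid α) : Prop :=
  ∃ M₁ M₂ : Matroid α, IsProperFactorization M M₁ M₂

end FreeProd

/-! A set `X` splits `M` as the free product of `M|X` and `M/X` exactly when every circuit of `M`
lies in `X` or spans `X` (`CutsFreely`). Pinchpoints have this property. Conversely, the first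
ground set of a proper free product has it, and the closure of the union of the circuits inside that
set is a pinchpoint. The factors of a free product are forced to be a restriction and a contraction,
which gives the uniqueness of the sharp factorization.

The link with the invariant is `IsPinchpoint.eq_of_rk_eq`: a pinchpoint is the only set of its rank
with at least as many elements. In characteristic zero, the invariant gives the number of orderings
with each rank sequence, hence the number of sets of each size and rank. So a set that is unique for
its size and rank has a counterpart `B` in `N`. A rank sequence then reveals whether its ordering
starts with that set, and cutting such orderings in two recovers the invariants of the restriction
and the contraction.

For the transfer of free products, bases of `N` always satisfy the conditions that define the bases
of the free product of `N|B` and `N/B`. The invariants of the factors determine how many sets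
satisfy them, and this number equals the number of bases for `M`, hence for `N`. Properness
transfers because having two cyclic flats means having two bases. -/

open Set

namespace FreeProd

variable {α : Type*} {M M₁ M₂ : Matroid α} {X F A B C : Set α}

/-! ### Cyclic flats, circuits and bases -/

lemma isCyclic_iff_forall_mem :
    IsCyclic M X ↔ ∀ e ∈ X, ∃ C, M.IsCircuit C ∧ e ∈ C ∧ C ⊆ X := by
  constructor
  · rintro ⟨𝒞, h𝒞, rfl⟩ e ⟨C, hC, he⟩
    exact ⟨C, h𝒞 C hC, he, subset_sUnion_of_mem hC⟩
  · intro h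
    refine ⟨{C | M.IsCircuit C ∧ C ⊆ X}, fun C hC ↦ hC.1, Subset.antisymm (fun e he ↦ ?_) ?_⟩
    · obtain ⟨C, hC, heC, hCX⟩ := h e he
      exact ⟨C, ⟨hC, hCX⟩, heC⟩
    · exact sUnion_subset fun C hC ↦ hC.2

lemma closure_mem_cyclicFlats (hX : IsCyclic M X) : M.closure X ∈ cyclicFlats M := by
  refine ⟨M.isFlat_closure X, isCyclic_iff_forall_mem.2 fun e he ↦ ?_⟩
  have hXE : X ⊆ M.E := by
    obtain ⟨𝒞, h𝒞, rfl⟩ := hX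
    exact sUnion_subset fun C hC ↦ (h𝒞 C hC).subset_ground
  have hXcl := M.subset_closure X
  by_cases heX : e ∈ X
  · obtain ⟨C, hC, heC, hCX⟩ := isCyclic_iff_forall_mem.1 hX e heX
    exact ⟨C, hC, heC, hCX.trans hXcl⟩
  · obtain ⟨C, hCX, hC, heC⟩ := Matroid.exists_isCircuit_of_mem_closure he heX
    exact ⟨C, hC, heC, hCX.trans (insert_subset he hXcl)⟩

lemma closure_isCircuit_mem_cyclicFlats (hC : M.IsCircuit C) :
    M.closure C ∈ cyclicFlats M :=
  closure_mem_cyclicFlats ⟨{C}, by simpa using hC, by simp⟩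

lemma loops_mem_cyclicFlats (M : Matroid α) : M.loops ∈ cyclicFlats M :=
  closure_mem_cyclicFlats ⟨∅, by simp, by simp⟩

lemma subset_of_forall_isCircuit (hF : IsCyclic M F) (h : ∀ C, M.IsCircuit C → C ⊆ F → C ⊆ X) :
    F ⊆ X := by
  intro e he
  obtain ⟨C, hC, heC, hCF⟩ := isCyclic_iff_forall_mem.1 hF e he
  exact h C hC hCF heC

lemma nontrivial_cyclicFlats_iff_isCircuit :
    (cyclicFlats M).Nontrivial ↔ ∃ C, M.IsCircuit C ∧ ¬ C ⊆ M.loops := by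
  constructor
  · rintro ⟨F, hF, F', hF', hne⟩
    by_contra! h
    have key : ∀ F ∈ cyclicFlats M, F = M.loops := fun F hF ↦
      (subset_of_forall_isCircuit hF.2 fun C hC _ ↦ h C hC).antisymm hF.1.loops_subset
    exact hne ((key F hF).trans (key F' hF').symm)
  · rintro ⟨C, hC, hCl⟩
    refine ⟨_, closure_isCircuit_mem_cyclicFlats hC, _, loops_mem_cyclicFlats M, fun h ↦ hCl ?_⟩
    exact h ▸ M.subset_closure C hC.subset_ground

/-- This turns properness into a count that the invariant determines. If a circuit `C` has a nonloop
`e`, then a base containing `C \ {e}` differs from a base containing `e`. Conversely, for `e` in one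
base and not in another, the fundamental circuit of `e` contains a nonloop. -/
lemma nontrivial_cyclicFlats_iff_isBase :
    (cyclicFlats M).Nontrivial ↔ {B | M.IsBase B}.Nontrivial := by
  rw [nontrivial_cyclicFlats_iff_isCircuit]
  constructor
  · rintro ⟨C, hC, hCl⟩
    obtain ⟨e, heC, hel⟩ := not_subset.1 hCl
    obtain ⟨B, hB, hCB⟩ := (hC.sdiff_singleton_indep heC).exists_isBase_superset
    obtain ⟨B', hB', heB'⟩ :=
      (Matroid.isNonloop_of_not_isLoop (hC.subset_ground heC) hel).exists_mem_isBase
    refine ⟨B', hB', B, hB, ?_⟩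
    rintro rfl
    refine hC.not_indep (hB.indep.subset fun x hx ↦ ?_)
    by_cases hxe : x = e
    · exact hxe ▸ heB'
    · exact hCB ⟨hx, hxe⟩
  · rintro ⟨B, hB, B', hB', hne⟩
    have hns : ¬ B ⊆ B' := fun h ↦ hne (hB.eq_of_subset_isBase hB' h)
    obtain ⟨e, heB, heB'⟩ := not_subset.1 hns
    refine ⟨_, hB'.fundCircuit_isCircuit (hB.subset_ground heB) heB', fun h ↦ ?_⟩
    exact (hB.indep.isNonloop_of_mem heB).not_isLoop (h (M.mem_fundCircuit e B'))

/-! ### Free products, circuits and pinchpoints -/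

/-- Every circuit that is not contained in `X` spans `X`. -/
def CutsFreely (M : Matroid α) (X : Set α) : Prop :=
  ∀ C, M.IsCircuit C → C ⊆ X ∨ X ⊆ M.closure C

lemma IsPinchpoint.cutsFreely (hX : IsPinchpoint M X) : CutsFreely M X := fun C hC ↦
  (hX.comparable _ (closure_isCircuit_mem_cyclicFlats hC)).symm.imp_left
    (M.subset_closure C hC.subset_ground).trans

lemma IsPinchpoint.subset_ground (hX : IsPinchpoint M X) : X ⊆ M.E := hX.mem.1.subset_ground

lemma CutsFreely.comparable (hX : CutsFreely M X) (hF : F ∈ cyclicFlats M) : X ⊆ F ∨ F ⊆ X := by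
  by_cases h : ∀ C, M.IsCircuit C → C ⊆ F → C ⊆ X
  · exact .inr (subset_of_forall_isCircuit hF.2 h)
  · push Not at h
    obtain ⟨C, hC, hCF, hCX⟩ := h
    left
    have := (hX C hC).resolve_left hCX
    exact this.trans (hF.1.closure ▸ M.closure_subset_closure hCF)

/-- The set `X` need not be a cyclic flat. Replacing it by the closure of its cyclic part keeps
every circuit inside `X` inside, and a circuit that spans `X` spans the new set too. -/
lemma CutsFreely.closure_isCyclicPart (hX : CutsFreely M X) :
    CutsFreely M (M.closure (⋃₀ {C | M.IsCircuit C ∧ C ⊆ X})) := by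
  intro C hC
  have hUE : (⋃₀ {C | M.IsCircuit C ∧ C ⊆ X}) ⊆ M.E :=
    sUnion_subset fun C hC ↦ hC.1.subset_ground
  rcases hX C hC with h | h
  · left
    refine subset_trans ?_ (M.subset_closure _ hUE)
    exact subset_sUnion_of_mem (show C ∈ {C | M.IsCircuit C ∧ C ⊆ X} from ⟨hC, h⟩)
  · right
    exact M.closure_subset_closure_of_subset_closure ((sUnion_subset fun C hC ↦ hC.2).trans h)

lemma eRank_restrict_add_eRank_contract (hXE : X ⊆ M.E) :
    (M.restrict X).eRank + (M.contract X).eRank = M.eRank := by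
  obtain ⟨I, hI⟩ := M.exists_isBasis X
  obtain ⟨J, hJ, hIJ⟩ := hI.indep.exists_isBase_superset
  have hJX : J ∩ X = I :=
    (hI.eq_of_subset_indep (hJ.indep.inter_right X) (subset_inter hIJ hI.subset)
      inter_subset_right).symm
  have h1 := hJ.isBasis_ground.contract_isBasis hI (hJ.indep.subset (union_subset sdiff_subset hIJ))
  have h2 : (M.contract X).IsBase (J \ X) := by
    rw [← Matroid.isBasis_ground_iff]; exact h1
  rw [← hJ.encard_eq_eRank, ← h2.encard_eq_eRank, Matroid.eRank_restrict,
    ← hI.encard_eq_eRk, ← hJX, add_comm, encard_sdiff_add_encard_inter]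

lemma CutsFreely.isFreeProduct [M.Finite] (hX : CutsFreely M X) (hXE : X ⊆ M.E) :
    IsFreeProduct M (M.restrict X) (M.contract X) where
  disjoint := by simpa using disjoint_sdiff_right
  ground := by simp [union_sdiff_cancel hXE]
  isBase_iff B := by
    rw [eRank_restrict_add_eRank_contract hXE]
    simp only [Matroid.restrict_ground_eq, Matroid.contract_ground, union_sdiff_cancel hXE,
      Matroid.restrict_indep_iff, inter_subset_right, and_true]
    have hd : (M.contract X).Spanning (B ∩ (M.E \ X)) ↔ M.Spanning (B ∩ (M.E \ X) ∪ X) := by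
      rw [Matroid.contract_spanning_iff hXE, and_iff_left]
      exact disjoint_sdiff_left.mono_left inter_subset_right
    rw [hd]
    constructor
    · intro hB
      refine ⟨hB.subset_ground, hB.encard_eq_eRank, hB.indep.inter_right X, ?_⟩
      refine hB.spanning_of_superset (fun x hx ↦ ?_) (union_subset ?_ hXE)
      · by_cases hxX : x ∈ X
        · exact .inr hxX
        · exact .inl ⟨hx, hB.subset_ground hx, hxX⟩
      · exact inter_subset_left.trans hB.subset_ground
    · rintro ⟨hBE, hcard, hind, hspan⟩
      have hBfin : B.Finite := M.ground_finite.subset hBE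
      by_cases hB : M.Indep B
      · refine hB.isBase_of_eRk_ge hBfin ?_
        rw [hB.eRk_eq_encard, hcard]
      -- A circuit in `B` cannot lie in `X`, so it spans `X`. Hence `B` spans `M`, and its size
      -- makes it a base.
      · obtain ⟨C, hCB, hC⟩ := ((Matroid.not_indep_iff hBE).1 hB).exists_isCircuit_subset
        have hCX : ¬ C ⊆ X := fun h ↦ hC.not_indep (hind.subset (subset_inter hCB h))
        have hXcl := ((hX C hC).resolve_left hCX).trans (M.closure_subset_closure hCB)
        have hsp : M.Spanning B := by
          rw [Matroid.spanning_iff_ground_subset_closure hBE, ← hspan.closure_eq]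
          refine M.closure_subset_closure_of_subset_closure (union_subset ?_ hXcl)
          exact inter_subset_left.trans (M.subset_closure B hBE)
        obtain ⟨B', hB', hB'B⟩ := hsp.exists_isBase_subset
        have : B' = B := (hBfin.subset hB'B).eq_of_subset_of_encard_le hB'B (by
            rw [hcard, hB'.encard_eq_eRank])
        exact this ▸ hB'

lemma IsFreeProduct.union_isBase {B₁ B₂ : Set α} (h : IsFreeProduct M M₁ M₂)
    (h₁ : M₁.IsBase B₁) (h₂ : M₂.IsBase B₂) : M.IsBase (B₁ ∪ B₂) := by
  have hd := h.disjoint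
  have e1 : (B₁ ∪ B₂) ∩ M₁.E = B₁ := by
    rw [union_inter_distrib_right, inter_eq_left.2 h₁.subset_ground,
      (hd.symm.mono_left h₂.subset_ground).inter_eq, union_empty]
  have e2 : (B₁ ∪ B₂) ∩ M₂.E = B₂ := by
    rw [union_inter_distrib_right, inter_eq_left.2 h₂.subset_ground,
      (hd.mono_left h₁.subset_ground).inter_eq, empty_union]
  rw [h.isBase_iff, e1, e2]
  refine ⟨union_subset_union h₁.subset_ground h₂.subset_ground, ?_, h₁.indep, h₂.spanning⟩
  rw [encard_union_eq (hd.mono h₁.subset_ground h₂.subset_ground), h₁.encard_eq_eRank,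
    h₂.encard_eq_eRank]

lemma IsFreeProduct.left_eq (h : IsFreeProduct M M₁ M₂) : M₁ = M.restrict M₁.E := by
  refine Matroid.ext_indep rfl fun I hI ↦ ?_
  rw [Matroid.restrict_indep_iff, and_iff_left hI]
  constructor
  · intro hI
    obtain ⟨B₁, hB₁, hIB⟩ := hI.exists_isBase_superset
    obtain ⟨B₂, hB₂⟩ := M₂.exists_isBase
    exact (h.union_isBase hB₁ hB₂).indep.subset (hIB.trans subset_union_left)
  · intro hI'
    obtain ⟨B, hB, hIB⟩ := hI'.exists_isBase_superset
    exact ((h.isBase_iff B).1 hB).2.2.1.subset (subset_inter hIB hI)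

/-- Fix a base `B₁` of `M₁`. The bases of the contraction are the `B` for which `B ∪ B₁` is a base
of `M`. Such a `B` spans `M₂`, and it cannot exceed a base of `M₂` because bases of `M` are
incomparable. -/
lemma IsFreeProduct.right_eq [M.Finite] (h : IsFreeProduct M M₁ M₂) :
    M₂ = M.contract M₁.E := by
  have hd := h.disjoint
  have hE : M₂.E = M.E \ M₁.E := by
    rw [h.ground, union_sdiff_left, hd.symm.sdiff_eq_left]
  have hE₁ : M₁.E ⊆ M.E := h.ground ▸ subset_union_left
  obtain ⟨B₁, hB₁⟩ := M₁.exists_isBase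
  obtain ⟨B₂, hB₂⟩ := M₂.exists_isBase
  have hbasis : M.IsBasis B₁ M₁.E := by
    rw [← Matroid.isBase_restrict_iff hE₁, ← h.left_eq]; exact hB₁
  have key : ∀ B, B ⊆ M₂.E → ((M.contract M₁.E).IsBase B ↔ M.IsBase (B ∪ B₁)) := by
    intro B hB
    have hdB : Disjoint M₁.E B := hd.mono_right hB
    constructor
    · intro hB'
      have hi := (hbasis.contract_indep_iff.1 hB'.indep).1
      have hs := ((Matroid.contract_spanning_iff hE₁).1 hB'.spanning).1
      refine hi.isBase_of_spanning ?_
      have hcl : M.closure (B ∪ B₁) = M.closure (B ∪ M₁.E) :=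
        M.closure_union_congr_right hbasis.closure_eq_closure
      rw [Matroid.spanning_iff_closure_eq hi.subset_ground, hcl, hs.closure_eq]
    · intro hB'
      refine Matroid.Indep.isBase_of_spanning ?_ ?_
      · exact hbasis.contract_indep_iff.2 ⟨hB'.indep, hdB⟩
      · rw [Matroid.contract_spanning_iff hE₁]
        refine ⟨hB'.spanning_of_superset (union_subset_union_right _ hB₁.subset_ground)
          (union_subset (hB.trans (hE ▸ sdiff_subset)) hE₁), hdB.symm⟩
  refine Matroid.ext_isBase hE fun B hB ↦ ?_
  rw [key B hB]
  constructor
  · exact fun hB' ↦ union_comm B B₁ ▸ h.union_isBase hB₁ hB'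
  · intro hB'
    have hs := ((h.isBase_iff _).1 hB').2.2.2
    rw [union_inter_distrib_right, inter_eq_left.2 hB,
      (hd.mono_left hB₁.subset_ground).inter_eq, union_empty] at hs
    obtain ⟨B₀, hB₀, hB₀B⟩ := hs.exists_isBase_subset
    have hb := h.union_isBase hB₁ hB₀
    have heq := hb.eq_of_subset_isBase hB' (union_comm B B₁ ▸ union_subset_union_right _ hB₀B)
    have : B = B₀ := by
      refine subset_antisymm (fun x hx ↦ ?_) hB₀B
      have hx' : x ∈ B₁ ∪ B₀ := heq ▸ .inl hx
      exact hx'.resolve_left fun h1 ↦ (hd.mono_left hB₁.subset_ground).le_bot ⟨h1, hB hx⟩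
    exact this ▸ hB₀

/-- Basis exchange. If a circuit `C` contains `f` outside `E(M₁)` and does not span `x` in `E(M₁)`,
extend `C - f + x` to a base. Trading `x` for `f` shrinks the independent part and enlarges the
spanning part, so the result is still a base, yet it contains `C`. -/
lemma IsFreeProduct.cutsFreely [M.Finite] (h : IsFreeProduct M M₁ M₂) : CutsFreely M M₁.E := by
  intro C hC
  by_contra! hcon
  obtain ⟨hC1, hC2⟩ := hcon
  obtain ⟨f, hfC, hf1⟩ := not_subset.1 hC1
  obtain ⟨x, hx1, hxC⟩ := not_subset.1 hC2
  have hxE : x ∈ M.E := h.ground ▸ Or.inl hx1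
  have hCi := hC.sdiff_singleton_indep hfC
  have hxf : x ∉ M.closure (C \ {f}) := by rwa [hC.closure_sdiff_singleton_eq]
  have hxC' : x ∉ C := fun hx ↦ hxC (M.mem_closure_of_mem hx hC.subset_ground)
  have hins : M.Indep (insert x (C \ {f})) := by
    rw [Matroid.insert_indep_iff]
    exact ⟨hCi, fun _ ↦ ⟨hxE, hxf⟩⟩
  obtain ⟨B, hB, hsub⟩ := hins.exists_isBase_superset
  have hxB : x ∈ B := hsub (mem_insert _ _)
  have hfB : f ∉ B := by
    intro hfB
    refine hC.not_indep (hB.indep.subset fun y hy ↦ ?_)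
    by_cases hyf : y = f
    · exact hyf ▸ hfB
    · exact hsub (.inr ⟨hy, hyf⟩)
  have hf2 : f ∈ M₂.E := (h.ground ▸ hC.subset_ground hfC : f ∈ M₁.E ∪ M₂.E).resolve_left hf1
  obtain ⟨hBE, hBc, hBi, hBs⟩ := (h.isBase_iff B).1 hB
  have hB' : M.IsBase (insert f (B \ {x})) := by
    rw [h.isBase_iff]
    refine ⟨insert_subset (.inr hf2) (sdiff_subset.trans hBE), ?_, hBi.subset ?_,
      hBs.superset ?_ inter_subset_right⟩
    · rw [encard_insert_of_notMem (fun hh ↦ hfB hh.1), encard_sdiff_singleton_add_one hxB, hBc]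
    · rintro y ⟨rfl | hy, hy1⟩
      · exact (hf1 hy1).elim
      · exact ⟨hy.1, hy1⟩
    · rintro y ⟨hy, hy2⟩
      refine ⟨.inr ⟨hy, ?_⟩, hy2⟩
      rintro rfl
      exact h.disjoint.le_bot ⟨hx1, hy2⟩
  refine hC.not_indep (hB'.indep.subset fun y hy ↦ ?_)
  by_cases hyf : y = f
  · exact .inl hyf
  · exact .inr ⟨hsub (.inr ⟨hy, hyf⟩), fun hyx ↦ hxC' (hyx ▸ hy)⟩

lemma IsProperFactorization.exists_isPinchpoint [M.Finite] (h : IsProperFactorization M M₁ M₂) :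
    ∃ X, IsPinchpoint M X := by
  have hfree := h.toIsFreeProduct.cutsFreely
  have hE₁ : M₁.E ⊆ M.E := h.ground ▸ subset_union_left
  refine ⟨_, ⟨closure_mem_cyclicFlats ⟨{C | M.IsCircuit C ∧ C ⊆ M₁.E}, fun C hC ↦ hC.1, rfl⟩,
    fun hg ↦ ?_, fun hl ↦ ?_, fun F hF ↦ hfree.closure_isCyclicPart.comparable hF⟩⟩
  · obtain ⟨D, hD, hDl⟩ := nontrivial_cyclicFlats_iff_isCircuit.1 h.right_nontrivial
    rw [h.toIsFreeProduct.right_eq] at hD hDl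
    obtain ⟨C, hC, hDC, -⟩ := hD.exists_subset_isCircuit_of_contract
    have hCcl := hg.2 (closure_isCircuit_mem_cyclicFlats hC)
    -- Loops of the contraction are the elements of the closure of `E(M₁)` outside `E(M₁)`. A
    -- greatest cyclic flat within this closure would make all of `D` loops.
    rw [Matroid.contract_loops_eq] at hDl
    refine hDl fun x hx ↦ ⟨?_, (hD.subset_ground hx).2⟩
    refine M.closure_subset_closure (sUnion_subset fun C hC ↦ hC.2) (hCcl ?_)
    exact M.subset_closure C hC.subset_ground (hDC hx)
  · obtain ⟨C, hC, hCl⟩ := nontrivial_cyclicFlats_iff_isCircuit.1 h.left_nontrivial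
    rw [h.toIsFreeProduct.left_eq] at hC hCl
    rw [Matroid.restrict_isCircuit_iff hE₁] at hC
    rw [Matroid.restrict_loops_eq hE₁] at hCl
    refine hCl (subset_inter (subset_trans ?_ (hl.2 (loops_mem_cyclicFlats M))) hC.2)
    refine subset_trans ?_ (M.subset_closure _ (sUnion_subset fun C hC ↦ hC.1.subset_ground))
    exact subset_sUnion_of_mem (show C ∈ {C | M.IsCircuit C ∧ C ⊆ M₁.E} from hC)

lemma IsPinchpoint.isSharpFactorization [M.Finite] (hX : IsPinchpoint M X) :
    IsSharpFactorization M (M.restrict X) (M.contract X) where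
  toIsFreeProduct := hX.cutsFreely.isFreeProduct hX.subset_ground
  left_nontrivial := by
    rw [nontrivial_cyclicFlats_iff_isCircuit]
    by_contra! h
    refine hX.not_least ⟨hX.mem, fun F hF ↦ ?_⟩
    refine subset_trans (subset_of_forall_isCircuit hX.mem.2 fun C hC hCX ↦ ?_) hF.1.loops_subset
    have := h C ((Matroid.restrict_isCircuit_iff hX.subset_ground).2 ⟨hC, hCX⟩)
    rw [Matroid.restrict_loops_eq hX.subset_ground] at this
    exact this.trans inter_subset_left
  right_nontrivial := by
    rw [nontrivial_cyclicFlats_iff_isCircuit]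
    have hl : (M.contract X).loops = ∅ := by
      rw [Matroid.contract_loops_eq, hX.mem.1.closure, Set.sdiff_self]
    by_contra! h
    refine hX.not_greatest ⟨hX.mem, fun F hF ↦ subset_of_forall_isCircuit hF.2 fun C hC _ ↦ ?_⟩
    by_contra hCX
    obtain ⟨D, -, hD⟩ := (hC.contract_dep_of_not_subset hCX).exists_isCircuit_subset
    have := h D hD
    rw [hl, subset_empty_iff] at this
    exact hD.nonempty.ne_empty this
  left_no_coloops := by
    refine eq_empty_of_forall_notMem fun e he ↦ ?_
    obtain ⟨C, hC, heC, hCX⟩ := isCyclic_iff_forall_mem.1 hX.mem.2 e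
      ((M.restrict X).coloops_subset_ground he)
    exact Matroid.IsColoop.notMem_isCircuit he
      ((Matroid.restrict_isCircuit_iff hX.subset_ground).2 ⟨hC, hCX⟩) heC
  right_no_loops := by
    rw [Matroid.contract_loops_eq, hX.mem.1.closure, Set.sdiff_self]

lemma IsPinchpoint.isSharpFactorization_iff [M.Finite] (hX : IsPinchpoint M X)
    (M₁ M₂ : Matroid α) :
    (IsSharpFactorization M M₁ M₂ ∧ M₁.E = X) ↔ (M₁ = M.restrict X ∧ M₂ = M.contract X) := by
  constructor
  · rintro ⟨h, rfl⟩
    exact ⟨h.toIsFreeProduct.left_eq, h.toIsFreeProduct.right_eq⟩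
  · rintro ⟨rfl, rfl⟩
    exact ⟨hX.isSharpFactorization, rfl⟩

/-! ### Natural-number rank, and the extremality of pinchpoints -/

lemma cast_rk (M : Matroid α) [M.Finite] (A : Set α) : (rk M A : ℕ∞) = M.eRk A :=
  ENat.natCast_toNat (Matroid.eRk_ne_top_iff.2 (M.isRkFinite_set A))

lemma rk_mono (M : Matroid α) [M.Finite] {A B : Set α} (h : A ⊆ B) : rk M A ≤ rk M B := by
  have := M.eRk_mono h
  rw [← cast_rk, ← cast_rk] at this
  exact_mod_cast this

lemma rk_empty (M : Matroid α) : rk M ∅ = 0 := by simp [rk]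

lemma rk_restrict (M : Matroid α) {A X : Set α} (h : A ⊆ X) : rk (M.restrict X) A = rk M A := by
  rw [rk, Matroid.restrict_eRk_eq _ h, rk]

lemma contract_finite (M : Matroid α) [M.Finite] (X : Set α) : (M.contract X).Finite :=
  ⟨M.ground_finite.subset sdiff_subset⟩

lemma rk_contract_add (M : Matroid α) [M.Finite] {A X : Set α} (h : Disjoint A X) :
    rk (M.contract X) A + rk M X = rk M (A ∪ X) := by
  have := contract_finite M X
  obtain ⟨I, hI⟩ := M.exists_isBasis' X
  obtain ⟨J, hJ, hIJ⟩ := hI.indep.subset_isBasis'_of_subset (hI.subset.trans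
    (subset_union_right : X ⊆ A ∪ X))
  have hJX : J ∩ X = I :=
    (hI.eq_of_subset_indep (hJ.indep.inter_right X) (subset_inter hIJ hI.subset)
      inter_subset_right).symm
  have h1 := hJ.contract_isBasis' hI (hJ.indep.subset (union_subset sdiff_subset hIJ))
  rw [union_sdiff_right, h.sdiff_eq_left] at h1
  have : ((rk (M.contract X) A + rk M X : ℕ) : ℕ∞) = (rk M (A ∪ X) : ℕ) := by
    push_cast
    rw [cast_rk, cast_rk, cast_rk, ← h1.encard_eq_eRk, ← hI.encard_eq_eRk, ← hJ.encard_eq_eRk,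
      ← hJX, encard_sdiff_add_encard_inter]
  exact_mod_cast this

lemma rk_union_le (M : Matroid α) [M.Finite] (A : Set α) {B : Set α} (hB : B.Finite) :
    rk M (A ∪ B) ≤ rk M A + B.ncard := by
  have := M.eRk_union_le_eRk_add_encard A B
  rw [← cast_rk, ← cast_rk, ← hB.cast_ncard_eq] at this
  exact_mod_cast this

lemma indep_iff_rk (M : Matroid α) [M.Finite] (hA : A.Finite) :
    M.Indep A ↔ rk M A = A.ncard := by
  rw [Matroid.indep_iff_eRk_eq_encard_of_finite hA, ← cast_rk, ← hA.cast_ncard_eq]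
  exact_mod_cast Iff.rfl

lemma spanning_iff_rk (M : Matroid α) [M.Finite] (hA : A ⊆ M.E) :
    M.Spanning A ↔ rk M A = rk M M.E := by
  rw [Matroid.spanning_iff_eRk_le hA, ← M.eRk_ground, ← cast_rk, ← cast_rk, Nat.cast_le]
  exact ⟨fun h ↦ (rk_mono M hA).antisymm h, fun h ↦ h.ge⟩

lemma isBase_iff_rk (M : Matroid α) [M.Finite] (hA : A ⊆ M.E) :
    M.IsBase A ↔ A.ncard = rk M M.E ∧ rk M A = rk M M.E := by
  have hfin := M.ground_finite.subset hA
  constructor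
  · intro h
    have h1 := (indep_iff_rk M hfin).1 h.indep
    have h2 := (spanning_iff_rk M hA).1 h.spanning
    exact ⟨by omega, h2⟩
  · rintro ⟨h1, h2⟩
    exact ((indep_iff_rk M hfin).2 (by omega)).isBase_of_spanning ((spanning_iff_rk M hA).2 h2)

/-- If `A` contains a circuit not inside `X`, then `A` spans `X`, and equality of ranks puts `A`
inside the flat `X`. Otherwise the elements of `A \ X` are coloops of `M|A`, each costing a full
unit of rank, while an element of `X \ A` lies in a circuit of `X` and so can be dropped for free.
-/
lemma IsPinchpoint.eq_of_rk_eq [M.Finite] (hX : IsPinchpoint M X) (hA : A ⊆ M.E)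
    (hr : rk M A = rk M X) (hcard : X.ncard ≤ A.ncard) : A = X := by
  have hXE := hX.subset_ground
  have hAfin := M.ground_finite.subset hA
  have hXfin := M.ground_finite.subset hXE
  by_cases h : ∃ C, M.IsCircuit C ∧ C ⊆ A ∧ ¬ C ⊆ X
  · obtain ⟨C, hC, hCA, hCX⟩ := h
    have hXA := ((hX.cutsFreely C hC).resolve_left hCX).trans (M.closure_subset_closure hCA)
    have heq := (M.isRkFinite_set X).closure_eq_closure_of_subset_of_eRk_ge_eRk hXA (by
      rw [M.eRk_closure_eq, ← cast_rk, ← cast_rk, hr])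
    rw [hX.mem.1.closure, M.closure_closure] at heq
    exact eq_of_subset_of_ncard_le (heq ▸ M.subset_closure A hA) hcard hXfin
  · push Not at h
    obtain ⟨I, hI⟩ := M.exists_isBasis (A ∩ X) (inter_subset_left.trans hA)
    have hIA : I ∪ A \ X ⊆ A := union_subset (hI.subset.trans inter_subset_left) sdiff_subset
    have hind : M.Indep (I ∪ A \ X) := by
      rw [Matroid.indep_iff_forall_subset_not_isCircuit (hIA.trans hA)]
      intro C hC hCc
      have hCX := h C hCc (hC.trans hIA)
      exact hCc.not_indep (hI.indep.subset fun x hx ↦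
        (hC hx).resolve_right fun h' ↦ h'.2 (hCX hx))
    have hIfin := hAfin.subset (hI.subset.trans inter_subset_left)
    have hrI : rk M (A ∩ X) = I.ncard := by
      rw [← (indep_iff_rk M hIfin).1 hI.indep, rk, rk, hI.eRk_eq_eRk]
    have hle : I.ncard + (A \ X).ncard ≤ rk M A := by
      rw [← ncard_union_eq (disjoint_sdiff_right.mono_left (hI.subset.trans inter_subset_right))
        hIfin (hAfin.subset sdiff_subset), ← (indep_iff_rk M (hAfin.subset hIA)).1 hind]
      exact rk_mono M hIA
    have hA1 := ncard_inter_add_ncard_sdiff_eq_ncard A X hAfin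
    have hX1 := ncard_inter_add_ncard_sdiff_eq_ncard X A hXfin
    rw [inter_comm] at hX1
    have hXA : X ⊆ A := by
      intro e heX
      by_contra heA
      obtain ⟨C, hC, heC, hCX⟩ := isCyclic_iff_forall_mem.1 hX.mem.2 e heX
      -- Thus `r(X) ≤ r(A ∩ X) + |X \ A| - 1`, whereas `r(A) ≥ r(A ∩ X) + |A \ X|` and `|A \ X| ≥ |X
      -- \ A|`, contradicting equal ranks.
      have hcl : rk M (X \ {e}) = rk M X := by
        rw [rk, rk, ← M.eRk_closure_eq, Matroid.closure_sdiff_singleton_eq_closure, M.eRk_closure_eq]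
        exact M.closure_subset_closure (sdiff_subset_sdiff_left hCX)
          (hC.mem_closure_sdiff_singleton_of_mem heC)
      have hun : X \ {e} ⊆ (A ∩ X) ∪ (X \ A) \ {e} := by
        rintro x ⟨hx, hxe⟩
        by_cases hxA : x ∈ A
        · exact .inl ⟨hxA, hx⟩
        · exact .inr ⟨⟨hx, hxA⟩, hxe⟩
      have h1 := rk_mono M hun
      have hfin : (X \ A).Finite := hXfin.subset sdiff_subset
      have h2 := rk_union_le M (A ∩ X) (hfin.subset (sdiff_subset (t := {e})))
      have h3 := ncard_sdiff_singleton_add_one (s := X \ A) ⟨heX, heA⟩ hfin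
      omega
    have : X \ A = ∅ := sdiff_eq_empty.2 hXA
    rw [this, ncard_empty] at hX1
    rw [inter_eq_right.2 hXA] at hrI hA1
    exact (eq_of_subset_of_ncard_le hXA (by omega) hAfin).symm

end FreeProd

namespace FreeProd

variable {α β γ : Type*}

/-! ### Counting by fibres and counting orderings -/

lemma exists_equiv_of_ncard_fiber_eq {S : Set α} {T : Set β} (hS : S.Finite) (hT : T.Finite)
    (f : α → γ) (g : β → γ)
    (h : ∀ c, {a | a ∈ S ∧ f a = c}.ncard = {b | b ∈ T ∧ g b = c}.ncard) :
    ∃ e : S ≃ T, ∀ a, g (e a) = f a := by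
  have := hS.to_subtype
  have := hT.to_subtype
  have he : ∀ c, {a : S // f a = c} ≃ {b : T // g b = c} := by
    intro c
    refine Classical.choice (Finite.card_eq.1 ?_)
    rw [Nat.card_congr (Equiv.subtypeSubtypeEquivSubtypeInter (· ∈ S) (f · = c)),
      Nat.card_congr (Equiv.subtypeSubtypeEquivSubtypeInter (· ∈ T) (g · = c))]
    exact h c
  refine ⟨(Equiv.sigmaFiberEquiv fun a : S ↦ f a).symm.trans
    ((Equiv.sigmaCongrRight fun c ↦ (he c)).trans
      (Equiv.sigmaFiberEquiv fun b : T ↦ g b)), fun a ↦ ?_⟩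
  exact (he (f a) ⟨a, rfl⟩).2

lemma ncard_eq_of_ncard_fiber_eq {S : Set α} {T : Set β} (hS : S.Finite) (hT : T.Finite)
    (f : α → γ) (g : β → γ)
    (h : ∀ c, {a | a ∈ S ∧ f a = c}.ncard = {b | b ∈ T ∧ g b = c}.ncard) (P : γ → Prop) :
    {a | a ∈ S ∧ P (f a)}.ncard = {b | b ∈ T ∧ P (g b)}.ncard := by
  obtain ⟨e, he⟩ := exists_equiv_of_ncard_fiber_eq hS hT f g h
  refine ncard_congr (fun a ha ↦ e ⟨a, ha.1⟩) ?_ ?_ ?_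
  · intro a ha
    exact ⟨(e ⟨a, ha.1⟩).2, by rw [he]; exact ha.2⟩
  · intro a b ha hb hab
    simpa using e.injective (Subtype.ext hab)
  · intro b hb
    obtain ⟨a, ha⟩ := e.surjective ⟨b, hb.1⟩
    have hb' : (e a : β) = b := by rw [ha]
    refine ⟨a, ⟨a.2, ?_⟩, hb'⟩
    rw [← he, hb']
    exact hb.2

lemma ncard_eq_mul_of_ncard_fiber_eq {S : Set α} {T : Set β} (hS : S.Finite) (hT : T.Finite)
    {f : α → β} (hf : MapsTo f S T) {m : ℕ} (h : ∀ b ∈ T, {a | a ∈ S ∧ f a = b}.ncard = m) :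
    S.ncard = T.ncard * m := by
  classical
  lift S to Finset α using hS
  lift T to Finset β using hT
  rw [ncard_coe_finset, ncard_coe_finset, Finset.card_eq_sum_card_fiberwise hf, ← smul_eq_mul]
  refine Finset.sum_eq_card_nsmul fun b hb ↦ ?_
  rw [← h b hb, ← ncard_coe_finset]
  congr 1
  ext
  simp

/-- The lists that enumerate `S` without repetition. -/
def orderings (S : Set α) : Set (List α) := {l | l.Nodup ∧ {x | x ∈ l} = S}

lemma orderings_length {S : Set α} {l : List α} (hl : l ∈ orderings S) : l.length = S.ncard := by
  classical
  rw [← hl.2, ← List.toFinset_card_of_nodup hl.1, ← ncard_coe_finset]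
  simp

lemma image_ofFn_eq_orderings {S : Set α} :
    (fun π : Fin S.ncard ≃ S ↦ List.ofFn fun i ↦ (π i : α)) '' univ = orderings S := by
  ext l
  constructor
  · rintro ⟨π, -, rfl⟩
    refine ⟨List.nodup_ofFn.2 (Subtype.val_injective.comp π.injective), ?_⟩
    ext x
    simp only [List.mem_ofFn, mem_ofPred_eq]
    exact ⟨fun ⟨i, hi⟩ ↦ hi ▸ (π i).2, fun hx ↦ ⟨π.symm ⟨x, hx⟩, by simp⟩⟩
  · intro hl
    have hlen := orderings_length hl
    obtain ⟨hnd, rfl⟩ := hl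
    classical
    let e : Fin {x | x ∈ l}.ncard ≃ {x | x ∈ l} :=
      (finCongr hlen.symm).trans (hnd.getEquiv l)
    refine ⟨e, mem_univ _, ?_⟩
    refine List.ext_getElem (by simp [hlen]) fun i h1 h2 ↦ ?_
    simp [e]

lemma ofFn_injective (S : Set α) :
    Function.Injective (fun π : Fin S.ncard ≃ S ↦ List.ofFn fun i ↦ (π i : α)) := by
  intro π σ h
  have := List.ofFn_injective h
  exact Equiv.ext fun i ↦ Subtype.ext (congrFun this i)

lemma orderings_finite {S : Set α} (hS : S.Finite) : (orderings S).Finite := by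
  have := hS.to_subtype
  rw [← image_ofFn_eq_orderings]
  exact finite_univ.image _

lemma ncard_orderings {S : Set α} (hS : S.Finite) :
    (orderings S).ncard = S.ncard.factorial := by
  classical
  have := hS.fintype
  rw [← image_ofFn_eq_orderings, ncard_image_of_injective _ (ofFn_injective S), ncard_univ,
    Nat.card_eq_fintype_card]
  obtain ⟨e⟩ : Nonempty (Fin S.ncard ≃ S) := by
    rw [← Fintype.card_eq, Fintype.card_fin, ← Nat.card_eq_fintype_card, Nat.card_coe_set_eq]
  rw [Fintype.card_equiv e, Fintype.card_fin]

lemma orderings_nonempty {S : Set α} (hS : S.Finite) : (orderings S).Nonempty := by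
  rw [← ncard_pos (orderings_finite hS), ncard_orderings hS]
  exact Nat.factorial_pos _

/-- Concatenation is a bijection from pairs of orderings of `A` and `S \ A` to the orderings of `S`
that start with `A`. -/
lemma ncard_orderings_split {S A : Set α} (hAS : A ⊆ S) (P R : List α → Prop) :
    {l | l ∈ orderings S ∧ {x | x ∈ l.take A.ncard} = A ∧ P (l.take A.ncard) ∧
      R (l.drop A.ncard)}.ncard =
    {l | l ∈ orderings A ∧ P l}.ncard * {l | l ∈ orderings (S \ A) ∧ R l}.ncard := by
  rw [← ncard_prod, ← InjOn.ncard_image (f := fun p : List α × List α ↦ p.1 ++ p.2)]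
  · congr 1
    ext l
    constructor
    · rintro ⟨⟨hnd, rfl⟩, hA, hP, hR⟩
      refine ⟨(l.take A.ncard, l.drop A.ncard), ⟨⟨⟨hnd.take, hA⟩, hP⟩,
        ⟨⟨hnd.drop, ?_⟩, hR⟩⟩, by simp⟩
      have hd := (List.nodup_append.1 ((List.take_append_drop A.ncard l).symm ▸ hnd)).2.2
      ext x
      constructor
      · intro hx
        refine ⟨List.mem_of_mem_drop hx, fun hxA ↦ ?_⟩
        rw [← hA] at hxA
        exact hd x hxA x hx rfl
      · rintro ⟨hx, hxA⟩
        rw [← hA] at hxA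
        have hx' : x ∈ l.take A.ncard ++ l.drop A.ncard := by
          rw [List.take_append_drop]; exact hx
        exact (List.mem_append.1 hx').resolve_left hxA
    · rintro ⟨⟨a, b⟩, ⟨⟨ha, hPa⟩, ⟨hb, hRb⟩⟩, rfl⟩
      have hlen := orderings_length ha
      have h1 : (a ++ b).take A.ncard = a := by rw [← hlen, List.take_left]
      have h2 : (a ++ b).drop A.ncard = b := by rw [← hlen, List.drop_left]
      refine ⟨⟨?_, ?_⟩, ?_⟩
      · rw [List.nodup_append]
        refine ⟨ha.1, hb.1, fun x hx y hy hxy ↦ ?_⟩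
        subst hxy
        exact (hb.2 ▸ hy : x ∈ S \ A).2 (ha.2 ▸ hx)
      · ext x
        have e1 : x ∈ a ↔ x ∈ A := by rw [← ha.2]; rfl
        have e2 : x ∈ b ↔ x ∈ S \ A := by rw [← hb.2]; rfl
        simp only [mem_ofPred_eq, List.mem_append, e1, e2, mem_sdiff]
        constructor
        · rintro (h | h)
          exacts [hAS h, h.1]
        · intro h
          by_cases hxA : x ∈ A
          exacts [.inl hxA, .inr ⟨h, hxA⟩]
      · simp only [h1, h2]
        exact ⟨ha.2, hPa, hRb⟩
  · rintro ⟨a, b⟩ ⟨⟨ha, -⟩, -⟩ ⟨a', b'⟩ ⟨⟨ha', -⟩, -⟩ h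
    obtain ⟨h1, h2⟩ := List.append_inj h
      ((orderings_length ha).trans (orderings_length ha').symm)
    exact Prod.ext h1 h2

/-- Each set of size `s` is the initial segment of the same number of orderings. -/
lemma ncard_orderings_take {S : Set α} (hS : S.Finite) {s : ℕ} (hs : s ≤ S.ncard)
    (Q : Set α → Prop) :
    {l | l ∈ orderings S ∧ Q {x | x ∈ l.take s}}.ncard =
      {A | A ⊆ S ∧ A.ncard = s ∧ Q A}.ncard * (s.factorial * (S.ncard - s).factorial) := by
  refine ncard_eq_mul_of_ncard_fiber_eq ((orderings_finite hS).subset fun l hl ↦ hl.1)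
    (hS.finite_subsets.subset fun A hA ↦ hA.1) (f := fun l ↦ {x | x ∈ l.take s}) ?_ ?_
  · intro l ⟨hl, hQ⟩
    refine ⟨?_, ?_, hQ⟩
    · rw [← hl.2]
      exact fun x hx ↦ List.mem_of_mem_take hx
    · rw [← orderings_length (show l.take s ∈ orderings {x | x ∈ l.take s} from ⟨hl.1.take, rfl⟩),
        List.length_take, orderings_length hl, min_eq_left hs]
  · rintro A ⟨hAS, rfl, hQ⟩
    have h := ncard_orderings_split hAS (fun _ ↦ True) (fun _ ↦ True)
    simp only [and_true] at h
    rw [ofPred_mem_eq, ofPred_mem_eq, ncard_orderings (hS.subset hAS),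
      ncard_orderings (hS.subset sdiff_subset), ncard_sdiff hAS (hS.subset hAS)] at h
    rw [← h]
    congr 1
    ext l
    simp only [mem_ofPred_eq]
    constructor
    · rintro ⟨⟨h1, -⟩, h3⟩
      exact ⟨h1, h3⟩
    · rintro ⟨h1, h3⟩
      exact ⟨⟨h1, by rwa [h3]⟩, h3⟩

/-! ### Rank sequences as lists, and the coefficients of the invariant -/

/-- The successive rank increments when the entries of a list are added one by one to a set. -/
noncomputable def rankIncrements (M : Matroid α) : Set α → List α → List ℕ
  | _, [] => []
  | A, x :: l => (rk M (insert x A) - rk M A) :: rankIncrements M (insert x A) l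

lemma rankIncrements_length (M : Matroid α) (A : Set α) (l : List α) :
    (rankIncrements M A l).length = l.length := by
  induction l generalizing A with
  | nil => rfl
  | cons x l ih => simp [rankIncrements, ih]

lemma insert_union_mem_cons (x : α) (A : Set α) (l : List α) :
    insert x A ∪ {y | y ∈ l} = A ∪ {y | y ∈ x :: l} := by
  ext y
  simp only [mem_union, mem_insert_iff, mem_ofPred_eq, List.mem_cons]
  tauto

lemma rankIncrements_take (M : Matroid α) (A : Set α) (l : List α) (s : ℕ) :
    (rankIncrements M A l).take s = rankIncrements M A (l.take s) := by
  induction l generalizing A s with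
  | nil => simp [rankIncrements]
  | cons x l ih => cases s <;> simp [rankIncrements, ih]

lemma rankIncrements_drop (M : Matroid α) (A : Set α) (l : List α) (s : ℕ) :
    (rankIncrements M A l).drop s = rankIncrements M (A ∪ {x | x ∈ l.take s}) (l.drop s) := by
  induction l generalizing A s with
  | nil => simp [rankIncrements]
  | cons x l ih =>
    cases s with
    | zero => simp
    | succ s => rw [rankIncrements, List.drop_succ_cons, ih, insert_union_mem_cons]; simp

lemma rankIncrements_sum (M : Matroid α) [M.Finite] (A : Set α) (l : List α) :
    (rankIncrements M A l).sum + rk M A = rk M (A ∪ {x | x ∈ l}) := by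
  induction l generalizing A with
  | nil => simp [rankIncrements]
  | cons x l ih =>
    have h1 := rk_mono M (subset_insert x A)
    have h2 := ih (insert x A)
    rw [insert_union_mem_cons] at h2
    rw [rankIncrements, List.sum_cons]
    omega

lemma rankIncrements_restrict (M : Matroid α) {X A : Set α} {l : List α} (hA : A ⊆ X)
    (hl : {x | x ∈ l} ⊆ X) : rankIncrements (M.restrict X) A l = rankIncrements M A l := by
  induction l generalizing A with
  | nil => rfl
  | cons x l ih =>
    have hxA : insert x A ⊆ X := insert_subset (hl List.mem_cons_self) hA
    rw [rankIncrements, rankIncrements, rk_restrict M hA, rk_restrict M hxA,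
      ih hxA fun y hy ↦ hl (List.mem_cons_of_mem _ hy)]

/-- Contracting `X` lowers the ranks of all sets joined with `X` by the constant `r(X)`, which
cancels in the increments. -/
lemma rankIncrements_contract (M : Matroid α) [M.Finite] {X A : Set α} {l : List α}
    (hA : Disjoint A X) (hl : Disjoint {x | x ∈ l} X) :
    rankIncrements (M.contract X) A l = rankIncrements M (A ∪ X) l := by
  induction l generalizing A with
  | nil => rfl
  | cons x l ih =>
    have hxA : Disjoint (insert x A) X :=
      disjoint_insert_left.2 ⟨fun hx ↦ hl.le_bot ⟨List.mem_cons_self, hx⟩, hA⟩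
    have h1 := rk_contract_add M hA
    have h2 := rk_contract_add M hxA
    rw [rankIncrements, rankIncrements, ih hxA (hl.mono_left fun y hy ↦ List.mem_cons_of_mem _ hy),
      ← insert_union, ← h1, ← h2, Nat.add_sub_add_right]

lemma rankIncrements_getElem (M : Matroid α) (A : Set α) (l : List α) (i : ℕ)
    (hi : i < (rankIncrements M A l).length) :
    (rankIncrements M A l)[i] =
      rk M (A ∪ {x | x ∈ l.take (i + 1)}) - rk M (A ∪ {x | x ∈ l.take i}) := by
  induction l generalizing A i with
  | nil => simp [rankIncrements] at hi
  | cons x l ih =>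
    cases i with
    | zero => simp [rankIncrements, union_singleton]
    | succ i =>
      simp only [rankIncrements, List.getElem_cons_succ, List.take_succ_cons]
      rw [ih, insert_union_mem_cons, insert_union_mem_cons]

lemma rankSequence_eq (M : Matroid α) (π : Fin M.E.ncard ≃ M.E) :
    rankSequence M π = rankIncrements M ∅ (List.ofFn fun i ↦ (π i : α)) := by
  refine List.ext_getElem (by simp [rankSequence, rankIncrements_length]) fun i h1 h2 ↦ ?_
  have hi : i < M.E.ncard := by simpa [rankSequence] using h1
  rw [rankIncrements_getElem]
  simp only [rankSequence, List.getElem_ofFn, empty_union]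
  congr 2
  · ext x
    simp only [mem_image, mem_Iic, mem_ofPred_eq, List.mem_take_iff_getElem, List.length_ofFn,
      List.getElem_ofFn]
    constructor
    · rintro ⟨j, hj, rfl⟩
      exact ⟨j, by have := Fin.le_def.1 hj; simp at this; omega, rfl⟩
    · rintro ⟨j, hj, rfl⟩
      exact ⟨⟨j, by omega⟩, by rw [Fin.le_def]; simp; omega, rfl⟩
  · ext x
    simp only [mem_image, mem_Iio, mem_ofPred_eq, List.mem_take_iff_getElem, List.length_ofFn,
      List.getElem_ofFn]
    constructor
    · rintro ⟨j, hj, rfl⟩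
      exact ⟨j, by have := Fin.lt_def.1 hj; simp at this; omega, rfl⟩
    · rintro ⟨j, hj, rfl⟩
      exact ⟨⟨j, by omega⟩, by rw [Fin.lt_def]; simp; omega, rfl⟩

/-- The number of orderings of the ground set with a given rank sequence. -/
noncomputable def rankSequenceCount (M : Matroid α) (L : List ℕ) : ℕ :=
  {l | l ∈ orderings M.E ∧ rankIncrements M ∅ l = L}.ncard

lemma gInvariant_apply (K : Type*) [Field K] (M : Matroid α) [M.Finite] (L : List ℕ) :
    gInvariant K M L = (rankSequenceCount M L : K) := by
  classical
  have := M.ground_finite.fintype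
  rw [gInvariant, finsum_eq_sum_of_fintype, Finsupp.finsetSum_apply]
  simp only [Finsupp.single_apply]
  rw [Finset.sum_boole, rankSequenceCount, ← image_ofFn_eq_orderings, ← ncard_coe_finset,
    ← ncard_image_of_injective _ (ofFn_injective M.E)]
  congr 2
  ext l
  simp only [rankSequence_eq, mem_image, mem_ofPred_eq, mem_univ, true_and, Finset.coe_filter,
    Finset.mem_univ]
  constructor
  · rintro ⟨π, h, rfl⟩
    exact ⟨⟨π, rfl⟩, h⟩
  · rintro ⟨⟨π, rfl⟩, h⟩
    exact ⟨π, h, rfl⟩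

lemma gInvariant_eq_iff (K : Type*) [Field K] [CharZero K] (M : Matroid α) (N : Matroid β)
    [M.Finite] [N.Finite] :
    gInvariant K M = gInvariant K N ↔ ∀ L, rankSequenceCount M L = rankSequenceCount N L := by
  rw [Finsupp.ext_iff]
  simp only [gInvariant_apply, Nat.cast_inj]

end FreeProd

namespace FreeProd

variable {α β : Type*} {M M₁ M₂ : Matroid α} {N N₁ N₂ : Matroid β} {A : Set α} {B : Set β}

/-! ### What the rank sequence counts determine -/

lemma ncard_orderings_congr [M.Finite] [N.Finite]
    (h : ∀ L, rankSequenceCount M L = rankSequenceCount N L) (P : List ℕ → Prop) :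
    {l | l ∈ orderings M.E ∧ P (rankIncrements M ∅ l)}.ncard =
      {l | l ∈ orderings N.E ∧ P (rankIncrements N ∅ l)}.ncard :=
  ncard_eq_of_ncard_fiber_eq (orderings_finite M.ground_finite) (orderings_finite N.ground_finite)
    _ _ h P

lemma rankIncrements_sum_of_mem (M : Matroid α) [M.Finite] {l : List α} {S : Set α}
    (hl : l ∈ orderings S) : (rankIncrements M ∅ l).sum = rk M S := by
  have := rankIncrements_sum M ∅ l
  rwa [rk_empty, add_zero, empty_union, hl.2] at this

lemma rankIncrements_length_of_mem (M : Matroid α) {l : List α} {S : Set α}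
    (hl : l ∈ orderings S) : (rankIncrements M ∅ l).length = S.ncard := by
  rw [rankIncrements_length, orderings_length hl]

lemma exists_ordering_same_rankIncrements [M.Finite]
    (h : ∀ L, rankSequenceCount M L = rankSequenceCount N L) :
    ∃ l ∈ orderings M.E, ∃ l' ∈ orderings N.E, rankIncrements N ∅ l' = rankIncrements M ∅ l := by
  obtain ⟨l, hl⟩ := orderings_nonempty M.ground_finite
  have h1 : 0 < rankSequenceCount M (rankIncrements M ∅ l) :=
    (ncard_pos ((orderings_finite M.ground_finite).subset fun _ h ↦ h.1)).2 ⟨l, hl, rfl⟩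
  rw [h] at h1
  obtain ⟨l', hl', h2⟩ := nonempty_of_ncard_ne_zero h1.ne'
  exact ⟨l, hl, l', hl', h2⟩

lemma ground_ncard_eq_of_rankSequenceCount_eq [M.Finite]
    (h : ∀ L, rankSequenceCount M L = rankSequenceCount N L) : M.E.ncard = N.E.ncard := by
  obtain ⟨l, hl, l', hl', h⟩ := exists_ordering_same_rankIncrements h
  rw [← rankIncrements_length_of_mem M hl, ← rankIncrements_length_of_mem N hl', h]

lemma rk_ground_eq_of_rankSequenceCount_eq [M.Finite] [N.Finite]
    (h : ∀ L, rankSequenceCount M L = rankSequenceCount N L) : rk M M.E = rk N N.E := by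
  obtain ⟨l, hl, l', hl', h⟩ := exists_ordering_same_rankIncrements h
  rw [← rankIncrements_sum_of_mem M hl, ← rankIncrements_sum_of_mem N hl', h]

lemma rankIncrements_take_sum (M : Matroid α) [M.Finite] (l : List α) (s : ℕ) :
    ((rankIncrements M ∅ l).take s).sum = rk M {x | x ∈ l.take s} := by
  have := rankIncrements_sum M ∅ (l.take s)
  rwa [rk_empty, add_zero, empty_union, ← rankIncrements_take] at this

/-- The number of sets of each size and rank is determined by the rank sequence counts. -/
lemma ncard_subsets_eq [M.Finite] [N.Finite]
    (h : ∀ L, rankSequenceCount M L = rankSequenceCount N L) (s k : ℕ) :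
    {A | A ⊆ M.E ∧ A.ncard = s ∧ rk M A = k}.ncard =
      {A | A ⊆ N.E ∧ A.ncard = s ∧ rk N A = k}.ncard := by
  have hn := ground_ncard_eq_of_rankSequenceCount_eq h
  by_cases hs : s ≤ M.E.ncard
  · have h1 := ncard_orderings_congr h (fun L ↦ (L.take s).sum = k)
    simp only [rankIncrements_take_sum] at h1
    rw [ncard_orderings_take M.ground_finite hs (fun A ↦ rk M A = k),
      ncard_orderings_take N.ground_finite (hn ▸ hs) (fun A ↦ rk N A = k), hn] at h1
    exact Nat.eq_of_mul_eq_mul_right (by positivity) h1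
  · rw [(_ : {A | A ⊆ M.E ∧ A.ncard = s ∧ rk M A = k} = ∅),
      (_ : {A | A ⊆ N.E ∧ A.ncard = s ∧ rk N A = k} = ∅), ncard_empty, ncard_empty]
    · refine eq_empty_of_forall_notMem fun A hA ↦ hs ?_
      rw [hn, ← hA.2.1]
      exact ncard_le_ncard hA.1 N.ground_finite
    · refine eq_empty_of_forall_notMem fun A hA ↦ hs ?_
      rw [← hA.2.1]
      exact ncard_le_ncard hA.1 M.ground_finite

lemma exists_powerset_equiv [M.Finite] [N.Finite]
    (h : ∀ L, rankSequenceCount M L = rankSequenceCount N L) :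
    ∃ e : 𝒫 M.E ≃ 𝒫 N.E, ∀ A, (e A : Set β).ncard = (A : Set α).ncard ∧
      rk N (e A : Set β) = rk M (A : Set α) := by
  obtain ⟨e, he⟩ := exists_equiv_of_ncard_fiber_eq (S := 𝒫 M.E) (T := 𝒫 N.E)
    M.ground_finite.finite_subsets N.ground_finite.finite_subsets
    (fun A ↦ (A.ncard, rk M A)) (fun A ↦ (A.ncard, rk N A)) (fun c ↦ by
      simpa [Prod.ext_iff] using ncard_subsets_eq h c.1 c.2)
  exact ⟨e, fun A ↦ Prod.ext_iff.1 (he A)⟩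

/-- `A` is the only subset of the ground set with its size and rank. -/
def IsUniqueOfRank (M : Matroid α) (A : Set α) : Prop :=
  ∀ A', A' ⊆ M.E → A'.ncard = A.ncard → rk M A' = rk M A → A' = A

lemma restrict_finite_of_subset [M.Finite] (hA : A ⊆ M.E) : (M.restrict A).Finite :=
  ⟨M.ground_finite.subset hA⟩

lemma setOf_mem_take_subset {S : Set α} {l : List α} (hl : l ∈ orderings S) (s : ℕ) :
    {x | x ∈ l.take s} ⊆ S := hl.2 ▸ fun _ hx ↦ List.mem_of_mem_take hx

lemma ncard_take {S : Set α} {l : List α} (hl : l ∈ orderings S) {s : ℕ} (hs : s ≤ S.ncard) :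
    {x | x ∈ l.take s}.ncard = s := by
  rw [← orderings_length (show l.take s ∈ orderings {x | x ∈ l.take s} from ⟨hl.1.take, rfl⟩),
    List.length_take, orderings_length hl, min_eq_left hs]

/-- The sum of the first terms is the rank of the initial segment, so uniqueness lets the rank
sequence alone detect that an ordering starts with `A`. -/
lemma IsUniqueOfRank.take_eq [M.Finite] (hA : A ⊆ M.E) (hu : IsUniqueOfRank M A) {l : List α}
    (hl : l ∈ orderings M.E) (h : ((rankIncrements M ∅ l).take A.ncard).sum = rk M A) :
    {x | x ∈ l.take A.ncard} = A :=
  hu _ (setOf_mem_take_subset hl _) (ncard_take hl (ncard_le_ncard hA M.ground_finite))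
    (by rw [← rankIncrements_take_sum, h])

lemma rankSequenceCount_restrict (M : Matroid α) (A : Set α) (a : List ℕ) :
    rankSequenceCount (M.restrict A) a = {l | l ∈ orderings A ∧ rankIncrements M ∅ l = a}.ncard := by
  rw [rankSequenceCount]
  congr 1
  ext l
  refine and_congr_right fun hl ↦ ?_
  rw [rankIncrements_restrict M (empty_subset A) (by rw [hl.2]; rfl)]

lemma rankSequenceCount_contract [M.Finite] (a : List ℕ) :
    rankSequenceCount (M.contract A) a =
      {l | l ∈ orderings (M.E \ A) ∧ rankIncrements M A l = a}.ncard := by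
  rw [rankSequenceCount]
  congr 1
  ext l
  refine and_congr_right fun hl ↦ ?_
  rw [rankIncrements_contract M (empty_disjoint A) (by rw [hl.2]; exact disjoint_sdiff_left),
    empty_union]

lemma rankSequenceCount_restrict_eq_zero [M.Finite] {a : List ℕ}
    (ha : ¬ (a.length = A.ncard ∧ a.sum = rk M A)) :
    rankSequenceCount (M.restrict A) a = 0 := by
  rw [rankSequenceCount_restrict]
  convert ncard_empty (List α)
  refine eq_empty_of_forall_notMem fun l hl ↦ ha ?_
  rw [← hl.2]
  exact ⟨rankIncrements_length_of_mem M hl.1, rankIncrements_sum_of_mem M hl.1⟩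

/-- Orderings whose rank sequence starts with `a` must start with `A`; the remaining elements then
come in any order, which is the factorial. -/
lemma IsUniqueOfRank.restrict_count [M.Finite] (hA : A ⊆ M.E) (hu : IsUniqueOfRank M A)
    {a : List ℕ} (ha : a.sum = rk M A) :
    rankSequenceCount (M.restrict A) a * (M.E.ncard - A.ncard).factorial =
      {l | l ∈ orderings M.E ∧ (rankIncrements M ∅ l).take A.ncard = a}.ncard := by
  have h := ncard_orderings_split hA (fun l ↦ rankIncrements M ∅ l = a) (fun _ ↦ True)
  simp only [and_true] at h
  rw [ofPred_mem_eq, ncard_orderings (M.ground_finite.subset sdiff_subset),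
    ncard_sdiff hA (M.ground_finite.subset hA), ← rankSequenceCount_restrict] at h
  rw [← h]
  congr 1
  ext l
  refine and_congr_right fun hl ↦ ?_
  rw [← rankIncrements_take]
  refine ⟨fun h ↦ h.2, fun h ↦ ⟨hu.take_eq hA hl (by rw [h, ha]), h⟩⟩

lemma IsUniqueOfRank.contract_count [M.Finite] (hA : A ⊆ M.E) (hu : IsUniqueOfRank M A)
    (b : List ℕ) :
    A.ncard.factorial * rankSequenceCount (M.contract A) b =
      {l | l ∈ orderings M.E ∧ (((rankIncrements M ∅ l).take A.ncard).sum = rk M A ∧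
        (rankIncrements M ∅ l).drop A.ncard = b)}.ncard := by
  have h := ncard_orderings_split hA (fun _ ↦ True) (fun l ↦ rankIncrements M A l = b)
  simp only [and_true, true_and] at h
  rw [ofPred_mem_eq, ncard_orderings (M.ground_finite.subset hA),
    ← rankSequenceCount_contract] at h
  rw [← h]
  congr 1
  ext l
  refine and_congr_right fun hl ↦ ?_
  rw [rankIncrements_drop, empty_union]
  constructor
  · rintro ⟨h1, h2⟩
    rw [rankIncrements_take_sum, h1]
    exact ⟨rfl, h2⟩
  · rintro ⟨h1, h2⟩
    have h3 := hu.take_eq hA hl h1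
    rw [h3] at h2
    exact ⟨h3, h2⟩

lemma IsUniqueOfRank.rankSequenceCount_restrict_eq [M.Finite] [N.Finite]
    (h : ∀ L, rankSequenceCount M L = rankSequenceCount N L)
    (hA : A ⊆ M.E) (hB : B ⊆ N.E) (huA : IsUniqueOfRank M A) (huB : IsUniqueOfRank N B)
    (hcard : A.ncard = B.ncard) (hrk : rk M A = rk N B) (a : List ℕ) :
    rankSequenceCount (M.restrict A) a = rankSequenceCount (N.restrict B) a := by
  by_cases ha : a.length = A.ncard ∧ a.sum = rk M A
  · have h1 := huA.restrict_count hA ha.2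
    have h2 := huB.restrict_count hB (hrk ▸ ha.2)
    rw [ncard_orderings_congr h (fun L ↦ L.take A.ncard = a), hcard, ← h2,
      ground_ncard_eq_of_rankSequenceCount_eq h] at h1
    exact Nat.eq_of_mul_eq_mul_right (Nat.factorial_pos _) h1
  · rw [rankSequenceCount_restrict_eq_zero ha,
      rankSequenceCount_restrict_eq_zero (by rwa [← hcard, ← hrk])]

lemma IsUniqueOfRank.rankSequenceCount_contract_eq [M.Finite] [N.Finite]
    (h : ∀ L, rankSequenceCount M L = rankSequenceCount N L)
    (hA : A ⊆ M.E) (hB : B ⊆ N.E) (huA : IsUniqueOfRank M A) (huB : IsUniqueOfRank N B)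
    (hcard : A.ncard = B.ncard) (hrk : rk M A = rk N B) (b : List ℕ) :
    rankSequenceCount (M.contract A) b = rankSequenceCount (N.contract B) b := by
  have h1 := huA.contract_count hA b
  have h2 := huB.contract_count hB b
  rw [ncard_orderings_congr h (fun L ↦ (L.take A.ncard).sum = rk M A ∧ L.drop A.ncard = b),
    hcard, hrk, ← h2] at h1
  exact Nat.eq_of_mul_eq_mul_left (Nat.factorial_pos _) h1

/-! ### Counting the bases of a free product -/

/-- The sets of size `r` that meet `E(M₁)` in an independent set and `E(M₂)` in a spanning set. -/
def freeBases (M₁ M₂ : Matroid α) (r : ℕ) : Set (Set α) :=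
  {B | B ⊆ M₁.E ∪ M₂.E ∧ B.ncard = r ∧ M₁.Indep (B ∩ M₁.E) ∧ M₂.Spanning (B ∩ M₂.E)}

lemma ncard_freeBases [M₁.Finite] [M₂.Finite] (hd : Disjoint M₁.E M₂.E) (r : ℕ) :
    (freeBases M₁ M₂ r).ncard =
      {p : 𝒫 M₁.E × 𝒫 M₂.E | (p.1 : Set α).ncard + (p.2 : Set α).ncard = r ∧
        rk M₁ p.1 = (p.1 : Set α).ncard ∧ rk M₂ p.2 = rk M₂ M₂.E}.ncard := by
  symm
  have key : ∀ p : 𝒫 M₁.E × 𝒫 M₂.E, ((p.1 : Set α) ∪ p.2) ∩ M₁.E = p.1 ∧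
      ((p.1 : Set α) ∪ p.2) ∩ M₂.E = p.2 := by
    rintro ⟨⟨I, hI⟩, ⟨S, hS⟩⟩
    simp only [mem_powerset_iff] at hI hS
    simp only [union_inter_distrib_right, inter_eq_left.2 hI, inter_eq_left.2 hS,
      (hd.mono_left hI).inter_eq, (hd.symm.mono_left hS).inter_eq, union_empty, empty_union,
      and_self]
  refine ncard_congr (fun p _ ↦ (p.1 : Set α) ∪ p.2) ?_ ?_ ?_
  · rintro p ⟨h1, h2, h3⟩
    have hf1 := M₁.ground_finite.subset p.1.2
    have hf2 := M₂.ground_finite.subset p.2.2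
    refine ⟨union_subset_union p.1.2 p.2.2, ?_, ?_, ?_⟩
    · rw [ncard_union_eq (hd.mono p.1.2 p.2.2) hf1 hf2, h1]
    · rwa [(key p).1, indep_iff_rk M₁ hf1]
    · rwa [(key p).2, spanning_iff_rk M₂ p.2.2]
  · rintro p q - - h
    refine Prod.ext (Subtype.ext ?_) (Subtype.ext ?_)
    · rw [← (key p).1, ← (key q).1, h]
    · rw [← (key p).2, ← (key q).2, h]
  · rintro B ⟨hB, hr, h1, h2⟩
    have hf1 : (B ∩ M₁.E).Finite := M₁.ground_finite.subset inter_subset_right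
    have hf2 : (B ∩ M₂.E).Finite := M₂.ground_finite.subset inter_subset_right
    have hun : B ∩ M₁.E ∪ B ∩ M₂.E = B := by
      rw [← inter_union_distrib_left, inter_eq_left.2 hB]
    refine ⟨(⟨B ∩ M₁.E, inter_subset_right⟩, ⟨B ∩ M₂.E, inter_subset_right⟩), ⟨?_, ?_, ?_⟩, hun⟩
    · rw [← ncard_union_eq (hd.mono inter_subset_right inter_subset_right) hf1 hf2, hun, hr]
    · rwa [← indep_iff_rk M₁ hf1]
    · rwa [← spanning_iff_rk M₂ inter_subset_right]

/-- Independence and spanning depend only on size and rank, so bijections of the power sets that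
preserve both carry one count to the other. -/
lemma ncard_freeBases_eq [M₁.Finite] [M₂.Finite] [N₁.Finite] [N₂.Finite]
    (hM : Disjoint M₁.E M₂.E) (hN : Disjoint N₁.E N₂.E)
    (h₁ : ∀ L, rankSequenceCount M₁ L = rankSequenceCount N₁ L)
    (h₂ : ∀ L, rankSequenceCount M₂ L = rankSequenceCount N₂ L) (r : ℕ) :
    (freeBases M₁ M₂ r).ncard = (freeBases N₁ N₂ r).ncard := by
  obtain ⟨e₁, he₁⟩ := exists_powerset_equiv h₁
  obtain ⟨e₂, he₂⟩ := exists_powerset_equiv h₂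
  rw [ncard_freeBases hM, ncard_freeBases hN,
    ← ncard_image_of_injective _ (e₁.prodCongr e₂).injective]
  congr 1
  rw [Equiv.image_eq_preimage_symm]
  ext p
  have h3 := he₁ (e₁.symm p.1)
  have h4 := he₂ (e₂.symm p.2)
  rw [e₁.apply_symm_apply] at h3
  rw [e₂.apply_symm_apply] at h4
  simp only [mem_preimage, mem_ofPred_eq, Equiv.prodCongr_symm, Equiv.prodCongr_apply,
    Prod.map_fst, Prod.map_snd, ← h3.1, ← h3.2, ← h4.1, ← h4.2,
    rk_ground_eq_of_rankSequenceCount_eq h₂]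

lemma setOf_isBase_eq (M : Matroid α) [M.Finite] :
    {B | M.IsBase B} = {B | B ⊆ M.E ∧ B.ncard = rk M M.E ∧ rk M B = rk M M.E} := by
  ext B
  exact ⟨fun h ↦ ⟨h.subset_ground, (isBase_iff_rk M h.subset_ground).1 h⟩,
    fun h ↦ (isBase_iff_rk M h.1).2 h.2⟩

lemma ncard_isBase_eq [M.Finite] [N.Finite]
    (h : ∀ L, rankSequenceCount M L = rankSequenceCount N L) :
    {B | M.IsBase B}.ncard = {B | N.IsBase B}.ncard := by
  rw [setOf_isBase_eq, setOf_isBase_eq, ncard_subsets_eq h,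
    rk_ground_eq_of_rankSequenceCount_eq h]

lemma finite_setOf_isBase (M : Matroid α) [M.Finite] : {B | M.IsBase B}.Finite :=
  M.ground_finite.finite_subsets.subset fun _ h ↦ h.subset_ground

lemma nontrivial_cyclicFlats_of_rankSequenceCount_eq [M.Finite] [N.Finite]
    (h : ∀ L, rankSequenceCount M L = rankSequenceCount N L) (hM : (cyclicFlats M).Nontrivial) :
    (cyclicFlats N).Nontrivial := by
  rw [nontrivial_cyclicFlats_iff_isBase] at hM ⊢
  have := (finite_setOf_isBase M).to_subtype
  have := (finite_setOf_isBase N).to_subtype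
  rwa [← one_lt_ncard_iff_nontrivial, ← ncard_isBase_eq h, one_lt_ncard_iff_nontrivial]

lemma isFreeProduct_iff_freeBases [M.Finite] (hA : A ⊆ M.E) :
    IsFreeProduct M (M.restrict A) (M.contract A) ↔
      {B | M.IsBase B} = freeBases (M.restrict A) (M.contract A) (rk M M.E) := by
  have hE : (M.restrict A).E ∪ (M.contract A).E = M.E := union_sdiff_cancel hA
  have hr : ∀ B, B ⊆ M.E → (B.encard = (M.restrict A).eRank + (M.contract A).eRank ↔
      B.ncard = rk M M.E) := by
    intro B hB
    rw [eRank_restrict_add_eRank_contract hA, ← M.eRk_ground, ← cast_rk,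
      ← (M.ground_finite.subset hB).cast_ncard_eq, Nat.cast_inj]
  have hiff : ∀ B, (B ⊆ (M.restrict A).E ∪ (M.contract A).E ∧
      B.encard = (M.restrict A).eRank + (M.contract A).eRank ∧
      (M.restrict A).Indep (B ∩ (M.restrict A).E) ∧
      (M.contract A).Spanning (B ∩ (M.contract A).E)) ↔
      B ∈ freeBases (M.restrict A) (M.contract A) (rk M M.E) := by
    intro B
    refine and_congr_right fun hB ↦ and_congr_left fun _ ↦ hr B (hE ▸ hB)
  constructor
  · intro h
    ext B
    rw [← hiff]
    exact h.isBase_iff B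
  · intro h
    refine ⟨disjoint_sdiff_right, hE.symm, fun B ↦ ?_⟩
    rw [hiff, ← h]
    rfl

/-- This inclusion needs nothing of `A`, so being a free product reduces to an equality of
cardinalities. -/
lemma setOf_isBase_subset_freeBases [M.Finite] (hA : A ⊆ M.E) :
    {B | M.IsBase B} ⊆ freeBases (M.restrict A) (M.contract A) (rk M M.E) := by
  intro B hB
  refine ⟨hB.subset_ground.trans (union_sdiff_cancel hA).symm.subset,
    ((isBase_iff_rk M hB.subset_ground).1 hB).1,
    Matroid.restrict_indep_iff.2 ⟨hB.indep.inter_right A, inter_subset_right⟩, ?_⟩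
  convert hB.spanning.contract A using 1
  rw [Matroid.contract_ground, ← inter_sdiff_assoc, inter_eq_left.2 hB.subset_ground]

/-! ### Transfer between matroids with the same invariant -/

lemma IsPinchpoint.isUniqueOfRank [M.Finite] (hA : IsPinchpoint M A) : IsUniqueOfRank M A :=
  fun _ hA' hc hr ↦ hA.eq_of_rk_eq hA' hr hc.ge

lemma IsUniqueOfRank.exists_isUniqueOfRank [M.Finite] [N.Finite]
    (h : ∀ L, rankSequenceCount M L = rankSequenceCount N L) (hA : A ⊆ M.E)
    (hu : IsUniqueOfRank M A) :
    ∃ B ⊆ N.E, A.ncard = B.ncard ∧ rk M A = rk N B ∧ IsUniqueOfRank N B := by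
  have h1 := ncard_subsets_eq h A.ncard (rk M A)
  have h2 : {A' | A' ⊆ M.E ∧ A'.ncard = A.ncard ∧ rk M A' = rk M A} = {A} := by
    ext A'
    refine ⟨fun ⟨a, b, c⟩ ↦ hu A' a b c, ?_⟩
    rintro rfl
    exact ⟨hA, rfl, rfl⟩
  rw [h2, ncard_singleton, eq_comm, ncard_eq_one] at h1
  obtain ⟨B, hB⟩ := h1
  have hmem : B ∈ {A' | A' ⊆ N.E ∧ A'.ncard = A.ncard ∧ rk N A' = rk M A} := hB ▸ rfl
  refine ⟨B, hmem.1, hmem.2.1.symm, hmem.2.2.symm, fun B' h1 h2 h3 ↦ ?_⟩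
  have : B' ∈ {A' | A' ⊆ N.E ∧ A'.ncard = A.ncard ∧ rk N A' = rk M A} :=
    ⟨h1, h2.trans hmem.2.1, h3.trans hmem.2.2⟩
  rwa [hB] at this

lemma IsProperFreeProduct.of_rankSequenceCount_eq [M.Finite] [N.Finite]
    (h : ∀ L, rankSequenceCount M L = rankSequenceCount N L) (hM : IsProperFreeProduct M) :
    IsProperFreeProduct N := by
  obtain ⟨M₁, M₂, hM⟩ := hM
  obtain ⟨A, hA⟩ := hM.exists_isPinchpoint
  have hAE := hA.subset_ground
  obtain ⟨B, hBE, hc, hr, huB⟩ := hA.isUniqueOfRank.exists_isUniqueOfRank h hAE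
  have h₁ := hA.isUniqueOfRank.rankSequenceCount_restrict_eq h hAE hBE huB hc hr
  have h₂ := hA.isUniqueOfRank.rankSequenceCount_contract_eq h hAE hBE huB hc hr
  have := restrict_finite_of_subset hAE
  have := restrict_finite_of_subset hBE
  have := contract_finite M A
  have := contract_finite N B
  have hsharp := hA.isSharpFactorization
  refine ⟨N.restrict B, N.contract B, ?_, nontrivial_cyclicFlats_of_rankSequenceCount_eq h₁
    hsharp.left_nontrivial, nontrivial_cyclicFlats_of_rankSequenceCount_eq h₂
    hsharp.right_nontrivial⟩
  rw [isFreeProduct_iff_freeBases hBE]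
  -- The two sets have equal size for `M` and `A`, and both sizes are the same for `N` and `B`. It
  -- is not needed that `B` is a pinchpoint.
  refine eq_of_subset_of_ncard_le (setOf_isBase_subset_freeBases hBE) ?_ ?_
  · rw [← ncard_isBase_eq h, (isFreeProduct_iff_freeBases hAE).1 hsharp.toIsFreeProduct,
      rk_ground_eq_of_rankSequenceCount_eq h]
    exact (ncard_freeBases_eq disjoint_sdiff_right disjoint_sdiff_right h₁ h₂ _).ge
  · exact (N.ground_finite.finite_subsets).subset fun C hC ↦
      hC.1.trans (union_sdiff_cancel hBE).subset

/-- The counterpart of `A` in `N` has the rank of `B`. Were it larger than `B`, extremality of `B`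
would force it to equal `B`. -/
lemma IsPinchpoint.ncard_le_of_rankSequenceCount_eq [M.Finite] [N.Finite]
    (h : ∀ L, rankSequenceCount M L = rankSequenceCount N L) (hA : IsPinchpoint M A)
    (hB : IsPinchpoint N B) (hr : rk M A = rk N B) : A.ncard ≤ B.ncard := by
  obtain ⟨C, hC, hc, hrC, -⟩ := hA.isUniqueOfRank.exists_isUniqueOfRank h hA.subset_ground
  by_contra! hlt
  have := hB.eq_of_rk_eq hC (hrC.symm.trans hr) (by omega)
  rw [this] at hc
  omega

end FreeProd

theorem theorem8p1 {K : Type*} [Field K] [CharZero K] {α : Type*} {β : Type*} :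
    -- being a proper free product is determined by the invariant
    (∀ (M : Matroid α) (N : Matroid β), M.Finite → N.Finite →
      FreeProd.gInvariant K M = FreeProd.gInvariant K N →
      (FreeProd.IsProperFreeProduct M ↔ FreeProd.IsProperFreeProduct N)) ∧
    -- the sharp factorization that corresponds to a pinchpoint
    (∀ (M : Matroid α), M.Finite → ∀ X : Set α, FreeProd.IsPinchpoint M X →
      ∀ M₁ M₂ : Matroid α,
        (FreeProd.IsSharpFactorization M M₁ M₂ ∧ M₁.E = X) ↔
          (M₁ = M.restrict X ∧ M₂ = M.contract X)) ∧
    -- the invariants of its constituents are determined by the invariant and the rank of `X`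
    (∀ (M : Matroid α) (N : Matroid β), M.Finite → N.Finite →
      ∀ (X : Set α) (Y : Set β), FreeProd.IsPinchpoint M X → FreeProd.IsPinchpoint N Y →
      FreeProd.gInvariant K M = FreeProd.gInvariant K N → M.eRk X = N.eRk Y →
        FreeProd.gInvariant K (M.restrict X) = FreeProd.gInvariant K (N.restrict Y) ∧
        FreeProd.gInvariant K (M.contract X) = FreeProd.gInvariant K (N.contract Y)) := by
  refine ⟨fun M N hM hN h ↦ ?_, fun M hM X hX ↦ hX.isSharpFactorization_iff,
    fun M N hM hN X Y hX hY h hr ↦ ?_⟩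
  · rw [FreeProd.gInvariant_eq_iff] at h
    exact ⟨.of_rankSequenceCount_eq h, .of_rankSequenceCount_eq fun L ↦ (h L).symm⟩
  · rw [FreeProd.gInvariant_eq_iff] at h
    have hr' : FreeProd.rk M X = FreeProd.rk N Y := congrArg ENat.toNat hr
    -- Only the ranks are assumed equal; equality of sizes follows by symmetry.
    have hc := (hX.ncard_le_of_rankSequenceCount_eq h hY hr').antisymm
      (hY.ncard_le_of_rankSequenceCount_eq (fun L ↦ (h L).symm) hX hr'.symm)
    have := FreeProd.restrict_finite_of_subset hX.subset_ground
    have := FreeProd.restrict_finite_of_subset hY.subset_ground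
    have := FreeProd.contract_finite M X
    have := FreeProd.contract_finite N Y
    rw [FreeProd.gInvariant_eq_iff, FreeProd.gInvariant_eq_iff]
    exact ⟨hX.isUniqueOfRank.rankSequenceCount_restrict_eq h hX.subset_ground hY.subset_ground
        hY.isUniqueOfRank hc hr',
      hX.isUniqueOfRank.rankSequenceCount_contract_eq h hX.subset_ground hY.subset_ground
        hY.isUniqueOfRank hc hr'⟩
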